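/- Let $d\ge 1$, let $\Omega\subset\mathbb{R}^d$ be a bounded, convex, open set, and let $p$ be a real number with $1<p<\infty$ if $d\in\{1,2\}$ and $1<p<\frac{d+2}{d-2}$ if $d\ge 3$. Let $H^1_0(\Omega)$ be the Sobolev space of real-valued functions that is the closure of $C_c^\infty(\Omega)$ for the inner product $$\langle f,g\rangle_{H^1}=\int_\Omega fg+\nabla f\cdot\nabla g ,$$ let $H^{-1}(\Omega)$ be its dual, and let $\mathcal{L}=I-\Delta:H^1_0(\Omega)\to H^{-1}(\Omega)$ be the invertible operator given by $(\mathcal{L}u)(v)=\langle u,v\rangle_{H^1}$. Let $\phi\in H^1_0(\Omega)$, $\phi\neq 0$, be a weak solution of $-\phi+\Delta\phi+|\phi|^{p-1}\phi=0$ with $\phi|_{\partial\Omega}=0$, i.e. $$\int_\Omega \nabla\phi\cdot\nabla v+\phi v-|\phi|^{p-1}\phi\,v=0\qquad\text{for all }v\in H^1_0(\Omega).$$ Then for every $h\in H^1_0(\Omega)$ the function $p|\phi|^{p-1}h$ defines an element $v\mapsto\int_\Omega p|\phi|^{p-1}h\,v$ of $H^{-1}(\Omega)$ (with absolutely convergent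 integrals), $T h=\mathcal{L}^{-1}(p|\phi|^{p-1}h)$ defines a bounded linear operator $T:H^1_0(\Omega)\to H^1_0(\Omega)$, and: 1. $T$ is compact, $T$ is self-adjoint with respect to $\langle\cdot,\cdot\rangle_{H^1}$, and its (complex) spectrum, i.e. the spectrum of its complexification, is contained in $\mathbb{R}$. 2. There are a complete orthonormal basis $(\psi_j)_{j\in\mathbb{N}}$ of $H^1_0(\Omega)$ and real numbers $(\nu_j)_{j\in\mathbb{N}}$ with $T\psi_j=\nu_j\psi_j$ and $\nu_j\ge 0$ for all $j$, and $\nu_j\to 0$ as $j\to\infty$. 3. $T\phi=p\phi$; that is, $p$ is an eigenvalue of $T$ with eigenfunction $\phi$. -/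

import Mathlib

open MeasureTheory Filter Topology
open scoped ContDiff TensorProduct

noncomputable section

namespace BoundState

/-- The ambient Hilbert space `L²(Ω) × L²(Ω; ℝᵈ)` of pairs `(u, g)`, with the inner product
`∫_Ω u v + g · h`. -/
abbrev PairSpace {d : ℕ} (Ω : Set (EuclideanSpace ℝ (Fin d))) : Type :=
  WithLp 2 (Lp ℝ 2 (volume.restrict Ω) × Lp (EuclideanSpace ℝ (Fin d)) 2 (volume.restrict Ω))

/-- The pairs `(u, ∇u)` with `u` a smooth function with compact support contained in `Ω`. -/
def testPairs {d : ℕ} (Ω : Set (EuclideanSpace ℝ (Fin d))) : Submodule ℝ (PairSpace Ω) where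
  carrier := {w | ∃ u : EuclideanSpace ℝ (Fin d) → ℝ,
    ContDiff ℝ ∞ u ∧ HasCompactSupport u ∧ tsupport u ⊆ Ω ∧
      w.fst =ᵐ[volume.restrict Ω] u ∧ w.snd =ᵐ[volume.restrict Ω] gradient u}
  zero_mem' := by
    refine ⟨0, contDiff_const, HasCompactSupport.zero, by simp, Lp.coeFn_zero _ _ _, ?_⟩
    have h : gradient (0 : EuclideanSpace ℝ (Fin d) → ℝ) = 0 := by
      funext x
      simp [gradient]
    rw [h]
    exact Lp.coeFn_zero _ _ _
  add_mem' := by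
    rintro a b ⟨u, hu, hu', hu'', hua, hga⟩ ⟨v, hv, hv', hv'', hvb, hgb⟩
    refine ⟨u + v, hu.add hv, hu'.add hv', ?_, ?_, ?_⟩
    · exact (tsupport_add u v).trans (Set.union_subset hu'' hv'')
    · exact (Lp.coeFn_add a.fst b.fst).trans (hua.add hvb)
    · have h : gradient (u + v) = gradient u + gradient v := by
        funext x
        have h1 := (hu.differentiable (by simp)) x
        have h2 := (hv.differentiable (by simp)) x
        simp [gradient, fderiv_add h1 h2]
      rw [h]
      exact (Lp.coeFn_add a.snd b.snd).trans (hga.add hgb)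
  smul_mem' := by
    rintro c a ⟨u, hu, hu', hu'', hua, hga⟩
    refine ⟨c • u, hu.const_smul c, hu'.mono (Function.support_const_smul_subset c u), ?_, ?_, ?_⟩
    · exact (closure_mono (Function.support_const_smul_subset c u)).trans hu''
    · exact (Lp.coeFn_smul c a.fst).trans (hua.const_smul c)
    · have h : gradient (c • u) = c • gradient u := by
        funext x
        have h1 := (hu.differentiable (by simp)) x
        simp [gradient, fderiv_const_smul h1 c]
      rw [h]
      exact (Lp.coeFn_smul c a.snd).trans (hga.const_smul c)

/-- The Sobolev space `H¹₀(Ω)`: the closure of the smooth functions with compact support in `Ω`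
for the norm `(∫_Ω u² + |∇u|²)^(1/2)`. A function is stored together with its weak gradient
(which it determines), so that the inherited inner product is `∫_Ω u v + ∇u · ∇v`. -/
abbrev H10 {d : ℕ} (Ω : Set (EuclideanSpace ℝ (Fin d))) : Type :=
  (testPairs Ω).topologicalClosure

/-- The function on `Ω` underlying an element of `H¹₀(Ω)` (up to null sets). -/
def H10.val {d : ℕ} {Ω : Set (EuclideanSpace ℝ (Fin d))} (u : H10 Ω) :
    EuclideanSpace ℝ (Fin d) → ℝ :=
  (u : PairSpace Ω).fst

/-- The weak gradient of an element of `H¹₀(Ω)` (up to null sets). -/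
def H10.grad {d : ℕ} {Ω : Set (EuclideanSpace ℝ (Fin d))} (u : H10 Ω) :
    EuclideanSpace ℝ (Fin d) → EuclideanSpace ℝ (Fin d) :=
  (u : PairSpace Ω).snd

/-- The inner product of `H¹₀(Ω)` is `∫_Ω u v + ∇u · ∇v`. -/
theorem H10.inner_eq {d : ℕ} {Ω : Set (EuclideanSpace ℝ (Fin d))} (u v : H10 Ω) :
    inner ℝ u v = ∫ x in Ω, (u.val x * v.val x + inner ℝ (u.grad x) (v.grad x)) := by
  rw [Submodule.coe_inner, WithLp.prod_inner_apply, L2.inner_def, L2.inner_def,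
    ← integral_add (L2.integrable_inner _ _) (L2.integrable_inner _ _)]
  refine integral_congr_ae (Eventually.of_forall fun x => ?_)
  exact congrArg₂ (· + ·) (mul_comm _ _) rfl

/-- Exponents that are superlinear and subcritical in dimension `d`: `1 < p`, and
`p < (d + 2) / (d - 2)` if `d ≥ 3`. -/
def Subcritical (d : ℕ) (p : ℝ) : Prop :=
  1 < p ∧ (3 ≤ d → p < ((d : ℝ) + 2) / ((d : ℝ) - 2))

/-- `φ ∈ H¹₀(Ω)` is a weak solution of `-φ + Δφ + |φ|^(p-1) φ = 0` in `Ω`, `φ = 0` on `∂Ω`. -/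
def IsWeakSolution {d : ℕ} {Ω : Set (EuclideanSpace ℝ (Fin d))} (p : ℝ) (φ : H10 Ω) : Prop :=
  ∀ v : H10 Ω, ∫ x in Ω, (inner ℝ (φ.grad x) (v.grad x) + φ.val x * v.val x
    - |φ.val x| ^ (p - 1) * φ.val x * v.val x) = 0

/-- The space `H⁻¹(Ω)`, the dual of `H¹₀(Ω)`. -/
abbrev HNeg {d : ℕ} (Ω : Set (EuclideanSpace ℝ (Fin d))) : Type :=
  StrongDual ℝ (H10 Ω)

/-- The operator `I - Δ : H¹₀(Ω) → H⁻¹(Ω)`, `((I - Δ) u) v = ∫_Ω u v + ∇u · ∇v`, which is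
invertible by the Riesz representation theorem. -/
def helmholtz {d : ℕ} (Ω : Set (EuclideanSpace ℝ (Fin d))) : H10 Ω ≃ₗᵢ[ℝ] HNeg Ω :=
  InnerProductSpace.toDual ℝ (H10 Ω)

/-- The function `f` on `Ω` belongs to `H⁻¹(Ω)`, where it is the functional `F`, that is
`F v = ∫_Ω f v` with an absolutely convergent integral for every `v ∈ H¹₀(Ω)`. -/
def IsFunctionalOf {d : ℕ} {Ω : Set (EuclideanSpace ℝ (Fin d))}
    (f : EuclideanSpace ℝ (Fin d) → ℝ) (F : HNeg Ω) : Prop :=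
  ∀ v : H10 Ω, IntegrableOn (fun x => f x * v.val x) Ω ∧ F v = ∫ x in Ω, f x * v.val x

/-- `T` is the operator `h ↦ (I - Δ)⁻¹ (p |φ|^(p-1) h)` from `H¹₀(Ω)` to itself. -/
def IsLinearizedOperator {d : ℕ} {Ω : Set (EuclideanSpace ℝ (Fin d))} (p : ℝ) (φ : H10 Ω)
    (T : H10 Ω →L[ℝ] H10 Ω) : Prop :=
  ∀ h : H10 Ω, ∃ F : HNeg Ω,
    IsFunctionalOf (fun x => p * |φ.val x| ^ (p - 1) * h.val x) F ∧ T h = (helmholtz Ω).symm F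

/-- The complex spectrum of an element of a real algebra (here: of bounded operators on a real
Hilbert space), which is its spectrum in the complexification `ℂ ⊗ A` of the algebra. -/
def complexSpectrum {A : Type*} [Ring A] [Algebra ℝ A] (a : A) : Set ℂ :=
  spectrum ℂ ((1 : ℂ) ⊗ₜ[ℝ] a : ℂ ⊗[ℝ] A)

end BoundState

end

/-! By the Riesz identification, `T` is the operator with `⟨T h, v⟩ = ∫ p|φ|^(p-1) h v`, so `T = S*
S`, where `S : H¹₀ → L²` multiplies by the square root of the potential. Symmetry, positivity and
the absolute convergence of the integrals are then immediate, and everything rests on the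
compactness of `S` (`exists_sqrtPotential_operator`).

Cut `φ` at a height `M`. Where `|φ|` is below `M` the weight is bounded and costs a multiple of the
`L²` norm of `u`. Where it is above, Hölder and the subcritical embedding `H¹₀ ⊆ L^(p+1)` cost the
tail of `φ` in `L^(p+1)` times the `H¹` norm, which is as small as desired. Rellich's theorem, in
the form that the `L²` norm is at most `ε` times the `H¹` norm on a subspace of finite codimension
(`exists_finiteDimensional_norm_toL2_le`), absorbs the first term. Hence `S` is a norm limit of
finite-rank operators.

The spectral theorem then gives an eigenbasis, indexed by `ℕ` because `H¹₀` is separable and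
infinite-dimensional. The complex spectrum is real because `(T - x)² + y²` is coercive for `y ≠ 0`.
Finally, the weak equation reads `⟨φ, v⟩ = ∫ |φ|^(p-1) φ v`, and multiplication by `p` turns it into
`T φ = p φ`. -/

noncomputable section

namespace BoundState

open scoped ENNReal NNReal

/-! ### Spectrum in the complexification of a real algebra -/

/-- Invertibility of `(a - x)² + y²` keeps `x + i y` out of the complex spectrum of `a`. -/
theorem notMem_complexSpectrum_of_isUnit {A : Type*} [Ring A] [Algebra ℝ A] {a : A} {z : ℂ}
    (h : IsUnit ((a - algebraMap ℝ A z.re) * (a - algebraMap ℝ A z.re)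
      + algebraMap ℝ A (z.im ^ 2))) :
    z ∉ complexSpectrum a := by
  -- The spectrum is the set where `z - a` fails to be a unit, so its complement is a double
  -- negation.
  refine not_not.2 ?_
  let j : A →ₐ[ℝ] ℂ ⊗[ℝ] A := Algebra.TensorProduct.includeRight
  let B : ℂ → ℂ ⊗[ℝ] A := fun w => w ⊗ₜ[ℝ] (1 : A) - (1 : ℂ) ⊗ₜ[ℝ] a
  have hexp : ∀ w : ℂ, B w * B (starRingEnd ℂ w)
      = (w * starRingEnd ℂ w) ⊗ₜ[ℝ] (1 : A) - (w + starRingEnd ℂ w) ⊗ₜ[ℝ] a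
        + (1 : ℂ) ⊗ₜ[ℝ] (a * a) := by
    intro w
    simp only [B, sub_mul, mul_sub, Algebra.TensorProduct.tmul_mul_tmul, mul_one, one_mul,
      TensorProduct.add_tmul]
    abel
  -- The expansion is symmetric in `w` and its conjugate. Commutation is what lets invertibility
  -- pass from the product to each factor.
  have hcomm : Commute (B z) (B (starRingEnd ℂ z)) := by
    have h1 := hexp z
    have h2 := hexp (starRingEnd ℂ z)
    rw [Complex.conj_conj] at h2
    rw [Commute, SemiconjBy, h1, h2, mul_comm z, add_comm z]
  have hprod : B z * B (starRingEnd ℂ z) = j ((a - algebraMap ℝ A z.re) *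
      (a - algebraMap ℝ A z.re) + algebraMap ℝ A (z.im ^ 2)) := by
    have h1 : (a - algebraMap ℝ A z.re) * (a - algebraMap ℝ A z.re) + algebraMap ℝ A (z.im ^ 2)
        = (z.re ^ 2 + z.im ^ 2) • (1 : A) - (2 * z.re) • a + a * a := by
      simp only [Algebra.algebraMap_eq_smul_one, sub_mul, mul_sub, smul_mul_assoc, mul_smul_comm,
        one_mul, mul_one, add_smul, mul_smul, two_smul, pow_two, smul_sub]
      abel
    have h2 : z * starRingEnd ℂ z = (z.re ^ 2 + z.im ^ 2) • (1 : ℂ) := by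
      rw [Complex.mul_conj, Complex.normSq_apply]
      simp [pow_two]
    have h3 : z + starRingEnd ℂ z = (2 * z.re) • (1 : ℂ) := by
      rw [Complex.add_conj]
      simp
    rw [hexp, h1, h2, h3]
    simp only [j, Algebra.TensorProduct.includeRight_apply, TensorProduct.tmul_add,
      TensorProduct.tmul_sub, TensorProduct.tmul_smul, TensorProduct.smul_tmul']
  have hj := h.map j
  rw [← hprod] at hj
  exact (hcomm.isUnit_mul_iff.1 hj).1

/-! ### Compact and self-adjoint operators on a real Hilbert space -/

section HilbertSpace

variable {H : Type*} [NormedAddCommGroup H] [InnerProductSpace ℝ H]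

/-- An operator on a Hilbert space that is arbitrarily small on subspaces of finite codimension
is compact. -/
theorem isCompactOperator_of_small_on_orthogonal {F : Type*} [NormedAddCommGroup F]
    [NormedSpace ℝ F] [CompleteSpace F] (S : H →L[ℝ] F)
    (hS : ∀ ε > 0, ∃ W : Submodule ℝ H, FiniteDimensional ℝ W ∧ ∀ u ∈ Wᗮ, ‖S u‖ ≤ ε * ‖u‖) :
    IsCompactOperator S := by
  choose! W hWfin hW using hS
  have hpos : ∀ n : ℕ, (0 : ℝ) < 1 / ((n : ℝ) + 1) := fun n => by positivity
  let V : ℕ → Submodule ℝ H := fun n => W (1 / ((n : ℝ) + 1))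
  have : ∀ n, FiniteDimensional ℝ (V n) := fun n => hWfin _ (hpos n)
  -- Finite-rank approximations: project onto `V n`, then apply `S`. The error is `S` on the
  -- orthogonal complement of `V n`, of norm at most `1/(n+1)`.
  let G : ℕ → H →L[ℝ] F := fun n => (S ∘L (V n).subtypeL) ∘L (V n).orthogonalProjectionOnto
  have hG : ∀ n, IsCompactOperator (G n) := fun n =>
    have h : IsCompactOperator (V n).orthogonalProjectionOnto :=
      have := FiniteDimensional.proper ℝ (V n)
      isCompactOperator_of_locallyCompactSpace_dom _
    h.clm_comp (S ∘L (V n).subtypeL)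
  have hlim : Tendsto G atTop (𝓝 S) := by
    rw [tendsto_iff_norm_sub_tendsto_zero]
    refine squeeze_zero (fun n => norm_nonneg _) (fun n => ?_)
      tendsto_one_div_add_atTop_nhds_zero_nat
    refine ContinuousLinearMap.opNorm_le_bound _ (hpos n).le fun u => ?_
    have h1 : (G n - S) u = - S (u - (V n).starProjection u) := by
      simp [G]
    rw [h1, norm_neg]
    refine (hW _ (hpos n) _ ((V n).sub_starProjection_mem_orthogonal u)).trans
      (mul_le_mul_of_nonneg_left ?_ (hpos n).le)
    rw [← Submodule.starProjection_orthogonal_val]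
    exact ((V n)ᗮ).norm_starProjection_apply_le u
  exact isCompactOperator_of_tendsto hlim (Eventually.of_forall hG)

/-- An orthonormal family in a separable space is countable. -/
theorem countable_of_orthonormal [TopologicalSpace.SeparableSpace H] {ι : Type*} {v : ι → H}
    (hv : Orthonormal ℝ v) : Countable ι := by
  refine Pairwise.countable_of_isOpen_disjoint (s := fun i => Metric.ball (v i) (1 / 2)) ?_
    (fun i => Metric.isOpen_ball) (fun i => ⟨v i, Metric.mem_ball_self (by norm_num)⟩)
  intro i j hij
  refine Metric.ball_disjoint_ball ?_
  -- Distinct vectors are `√2` apart, more than the sum `1` of the two radii.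
  have h : ‖v i - v j‖ ^ 2 = 2 := by
    rw [norm_sub_sq_real, hv.1, hv.1, hv.2 hij]
    norm_num
  rw [dist_eq_norm]
  nlinarith [norm_nonneg (v i - v j)]

/-- The eigenvalues of a compact self-adjoint operator along an orthonormal sequence of
eigenvectors tend to zero. -/
theorem tendsto_eigenvalues_zero {T : H →L[ℝ] H} (hT : IsCompactOperator T)
    (hsa : T.IsSymmetric) {v : ℕ → H} (hv : Orthonormal ℝ v) {ν : ℕ → ℝ}
    (hν : ∀ j, T (v j) = ν j • v j) : Tendsto ν atTop (𝓝 0) := by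
  obtain ⟨K, hK, hKsub⟩ := hT.image_closedBall_subset_compact (M₁ := H) (1 : ℝ)
  have hmem : ∀ j, T (v j) ∈ K := fun j => hKsub ⟨v j, by simp [hv.1 j], rfl⟩
  -- Bessel: the squared coefficients are summable, so the sequence tends weakly to zero. A strong
  -- limit of the images under `T` must therefore vanish.
  have hweak : ∀ y : H, Tendsto (fun j => inner ℝ (v j) y) atTop (𝓝 0) := by
    intro y
    have h := (hv.inner_products_summable y).tendsto_cofinite_zero
    rw [Nat.cofinite_eq_atTop] at h
    have h' := h.sqrt
    simp only [Real.sqrt_zero, norm_nonneg, Real.sqrt_sq] at h'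
    exact tendsto_zero_iff_norm_tendsto_zero.2 h'
  refine tendsto_of_subseq_tendsto fun ns hns => ?_
  obtain ⟨y, -, ms, hms, hlim⟩ := hK.tendsto_subseq fun k => hmem (ns k)
  have hsub : Tendsto (fun k => ns (ms k)) atTop atTop := hns.comp hms.tendsto_atTop
  have h0 : Tendsto (fun k => inner ℝ (T (v (ns (ms k)))) y) atTop (𝓝 0) := by
    have := (hweak (T y)).comp hsub
    refine this.congr fun k => ?_
    exact (hsa _ _).symm
  have h1 : Tendsto (fun k => inner ℝ (T (v (ns (ms k)))) y) atTop (𝓝 (inner ℝ y y)) :=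
    hlim.inner tendsto_const_nhds
  have hy : y = 0 := inner_self_eq_zero.1 (tendsto_nhds_unique h1 h0)
  refine ⟨ms, tendsto_zero_iff_norm_tendsto_zero.2 ?_⟩
  have h2 := hlim.norm
  rw [hy, norm_zero] at h2
  refine h2.congr fun k => ?_
  simp [hν, norm_smul, hv.1]

/-- A compact positive operator on a separable infinite-dimensional Hilbert space has an
orthonormal basis of eigenvectors, with nonnegative eigenvalues tending to zero. -/
theorem exists_hilbertBasis_eigenvectors [CompleteSpace H] [TopologicalSpace.SeparableSpace H] (hinf : ¬ FiniteDimensional ℝ H)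
    {T : H →L[ℝ] H} (hT : IsCompactOperator T) (hsa : T.IsSymmetric)
    (hpos : ∀ u, 0 ≤ inner ℝ (T u) u) :
    ∃ (ψ : HilbertBasis ℕ ℝ H) (ν : ℕ → ℝ),
      (∀ j, T (ψ j) = ν j • ψ j) ∧ (∀ j, 0 ≤ ν j) ∧ Tendsto ν atTop (𝓝 0) := by
  let V : ℝ → Submodule ℝ H := Module.End.eigenspace (T : Module.End ℝ H)
  have : ∀ μ, CompleteSpace (V μ) := fun μ => by
    have : IsClosed (V μ : Set H) := by
      have h : (V μ : Set H) = {x | T x = μ • x} := by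
        ext x; simp [V]
      rw [h]
      exact isClosed_eq T.continuous (continuous_const_smul μ)
    exact this.completeSpace_coe
  -- All real `μ` are taken, so the kernel, possibly infinite-dimensional, is included; the index
  -- set is empty when `μ` is not an eigenvalue.
  choose w b hb using fun μ => exists_hilbertBasis ℝ (V μ)
  let e : (Σ μ, w μ) → H := fun a => (b a.1 a.2 : V a.1)
  have he : Orthonormal ℝ e :=
    (hsa.orthogonalFamily_eigenspaces).orthonormal_sigma_orthonormal fun μ => (b μ).orthonormal
  have hcl : ∀ μ, V μ ≤ (Submodule.span ℝ (Set.range e)).topologicalClosure := by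
    intro μ x hx
    have h1 : (⟨x, hx⟩ : V μ) ∈ (Submodule.span ℝ (Set.range (b μ))).topologicalClosure := by
      rw [(b μ).dense_span]; trivial
    have h2 := map_mem_closure (V μ).subtypeL.continuous h1
      (t := (Submodule.span ℝ (Set.range e) : Set H)) (by
        intro y hy
        have hy' : (V μ).subtype y ∈ (Submodule.span ℝ (Set.range (b μ))).map (V μ).subtype :=
          ⟨y, hy, rfl⟩
        rw [Submodule.map_span] at hy'
        refine Submodule.span_mono ?_ hy'
        rintro _ ⟨_, ⟨i, rfl⟩, rfl⟩
        exact ⟨⟨μ, i⟩, rfl⟩)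
    exact h2
  have hbot : (Submodule.span ℝ (Set.range e))ᗮ = ⊥ := by
    rw [← Submodule.orthogonal_closure, eq_bot_iff,
      ← T.orthogonalComplement_iSup_eigenspaces_eq_bot hT hsa]
    exact Submodule.orthogonal_le (iSup_le hcl)
  have : Countable (Σ μ, w μ) := countable_of_orthonormal he
  have : Infinite (Σ μ, w μ) := by
    by_contra hfin
    rw [not_infinite_iff_finite] at hfin
    apply hinf
    have : FiniteDimensional ℝ (Submodule.span ℝ (Set.range e)) :=
      FiniteDimensional.span_of_finite ℝ (Set.finite_range e)
    -- A finite-dimensional span is closed, so a trivial orthogonal complement makes it the whole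
    -- space.
    have htop : Submodule.span ℝ (Set.range e) = ⊤ := (Submodule.orthogonal_eq_bot_iff).1 hbot
    rw [htop] at this
    exact Module.finite_def.2 (Module.Finite.iff_fg.1 this)
  obtain ⟨f⟩ : Nonempty (ℕ ≃ Σ μ, w μ) := nonempty_equiv_of_countable
  have hv : Orthonormal ℝ (e ∘ f) := he.comp f f.injective
  have hbot' : (Submodule.span ℝ (Set.range (e ∘ f)))ᗮ = ⊥ := by
    rwa [f.surjective.range_comp]
  have heig : ∀ j, T ((e ∘ f) j) = (f j).1 • (e ∘ f) j := fun j =>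
    Module.End.mem_eigenspace_iff.1 (b (f j).1 (f j).2 : V (f j).1).2
  refine ⟨HilbertBasis.mkOfOrthogonalEqBot hv hbot', fun j => (f j).1, ?_, fun j => ?_,
    tendsto_eigenvalues_zero hT hsa hv heig⟩
  · simpa only [HilbertBasis.coe_mkOfOrthogonalEqBot] using heig
  · have h := hpos ((e ∘ f) j)
    rw [heig, real_inner_smul_left, real_inner_self_eq_norm_sq, hv.1 j] at h
    simpa using h

/-- The complex spectrum of a self-adjoint operator on a real Hilbert space is real. -/
theorem im_eq_zero_of_mem_complexSpectrum [CompleteSpace H] {T : H →L[ℝ] H}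
    (hT : IsSelfAdjoint T) {z : ℂ} (hz : z ∈ complexSpectrum T) : z.im = 0 := by
  by_contra hne
  refine notMem_complexSpectrum_of_isUnit ?_ hz
  let R : H →L[ℝ] H := T - algebraMap ℝ _ z.re
  have hR : ∀ u v, inner ℝ (R u) v = inner ℝ u (R v) := by
    intro u v
    have := hT.isSymmetric u v
    simp only [ContinuousLinearMap.coe_coe] at this
    simp [R, inner_sub_left, inner_sub_right, this, Algebra.algebraMap_eq_smul_one,
      real_inner_smul_left, real_inner_smul_right]
  let M : H →L[ℝ] H := R * R + algebraMap ℝ _ (z.im ^ 2)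
  -- The form is `‖R u‖² + (im z)² ‖u‖²`; Lax–Milgram then inverts `M`.
  have hM : IsCoercive (innerSL ℝ ∘L M) := by
    refine ⟨z.im ^ 2, by positivity, fun u => ?_⟩
    have : (innerSL ℝ ∘L M) u u = ‖R u‖ ^ 2 + z.im ^ 2 * (‖u‖ * ‖u‖) := by
      change inner ℝ (M u) u = _
      have hMu : M u = R (R u) + (z.im ^ 2) • u := by
        simp [M, Algebra.algebraMap_eq_smul_one]
      rw [hMu, inner_add_left, hR, real_inner_smul_left, real_inner_self_eq_norm_sq,
        real_inner_self_eq_norm_mul_norm]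
    rw [this, mul_assoc]
    exact le_add_of_nonneg_left (sq_nonneg _)
  have hMe : M = (hM.continuousLinearEquivOfBilin : H →L[ℝ] H) := by
    ext u
    exact hM.unique_continuousLinearEquivOfBilin fun w => rfl
  change IsUnit M
  rw [hMe]
  exact ⟨ContinuousLinearEquiv.toUnit _, rfl⟩

end HilbertSpace

/-! ### Elementary quadratic inequalities for extended nonnegative reals -/

/-- The Cauchy-Schwarz inequality against the constant function `1`. -/
theorem sq_lintegral_le {α : Type*} [MeasurableSpace α] (μ : Measure α) {f : α → ℝ≥0∞}
    (hf : AEMeasurable f μ) : (∫⁻ x, f x ∂μ) ^ 2 ≤ μ Set.univ * ∫⁻ x, f x ^ 2 ∂μ := by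
  have h := ENNReal.lintegral_mul_le_Lp_mul_Lq μ (Real.HolderConjugate.two_two)
    hf (aemeasurable_const (b := (1 : ℝ≥0∞)))
  simp only [Pi.mul_apply, mul_one, ENNReal.one_rpow, lintegral_const, one_mul] at h
  have h2 : ∀ a : ℝ≥0∞, (a ^ (1 / 2 : ℝ)) ^ 2 = a := fun a => by
    rw [← ENNReal.rpow_natCast, ← ENNReal.rpow_mul]
    norm_num
  calc (∫⁻ x, f x ∂μ) ^ 2
      ≤ ((∫⁻ x, f x ^ (2 : ℝ) ∂μ) ^ (1 / 2 : ℝ) * (μ Set.univ) ^ (1 / 2 : ℝ)) ^ 2 := by gcongr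
    _ = μ Set.univ * ∫⁻ x, f x ^ 2 ∂μ := by
        rw [mul_pow, h2, h2, mul_comm]
        simp

theorem add_sq_le_two_mul (a b : ℝ≥0∞) : (a + b) ^ 2 ≤ 2 * a ^ 2 + 2 * b ^ 2 := by
  have h := ENNReal.rpow_add_le_mul_rpow_add_rpow a b (p := 2) (by norm_num)
  norm_num at h
  rwa [mul_add] at h

/-! ### Translation estimates and local averages -/

section Translation

variable {E : Type*} [NormedAddCommGroup E] [NormedSpace ℝ E]

/-- The increment of a `C¹` function is controlled by its derivative along the segment. -/
theorem enorm_add_sub_le_lintegral {u : E → ℝ} (hu : ContDiff ℝ 1 u) (x h : E) {a : ℝ}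
    (ha : 0 ≤ a) :
    ‖u (x + a • h) - u x‖ₑ ≤ ∫⁻ t in Set.Icc 0 a, ‖fderiv ℝ u (x + t • h)‖ₑ * ‖h‖ₑ := by
  have hline : ∀ t : ℝ, HasDerivAt (fun t : ℝ => x + t • h) h t := fun t => by
    simpa using ((hasDerivAt_id t).smul_const h).const_add x
  have hcd : ContDiff ℝ 1 (fun t : ℝ => u (x + t • h)) := by fun_prop
  have h1 := enorm_sub_le_lintegral_deriv_of_contDiffOn_Icc (hcd.contDiffOn (s := Set.Icc 0 a)) ha
  simp only [zero_smul, add_zero] at h1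
  refine h1.trans (lintegral_mono fun t => ?_)
  have hd : HasDerivAt (fun t : ℝ => u (x + t • h)) (fderiv ℝ u (x + t • h) h) t :=
    ((hu.differentiable one_ne_zero (x + t • h)).hasFDerivAt).comp_hasDerivAt t (hline t)
  rw [hd.deriv]
  exact ContinuousLinearMap.le_opENorm _ _

variable [FiniteDimensional ℝ E] [MeasurableSpace E] [BorelSpace E] (μ : Measure E)
  [μ.IsAddHaarMeasure]

/-- The `L²` modulus of continuity of a `C¹` function under translations. -/
theorem lintegral_translate_sub_sq_le {u : E → ℝ} (hu : ContDiff ℝ 1 u) (h : E) :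
    ∫⁻ x, ‖u (x + h) - u x‖ₑ ^ 2 ∂μ ≤ ‖h‖ₑ ^ 2 * ∫⁻ x, ‖fderiv ℝ u x‖ₑ ^ 2 ∂μ := by
  have hcont : Continuous (fderiv ℝ u) := hu.continuous_fderiv one_ne_zero
  have hpt : ∀ x, ‖u (x + h) - u x‖ₑ ^ 2
      ≤ ∫⁻ t in Set.Icc (0 : ℝ) 1, ‖fderiv ℝ u (x + t • h)‖ₑ ^ 2 * ‖h‖ₑ ^ 2 := by
    intro x
    have h1 := enorm_add_sub_le_lintegral hu x h zero_le_one
    rw [one_smul] at h1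
    have hm : Measurable fun t : ℝ => ‖fderiv ℝ u (x + t • h)‖ₑ * ‖h‖ₑ := by
      have : Continuous fun t : ℝ => fderiv ℝ u (x + t • h) := by fun_prop
      exact (this.enorm.measurable).mul_const _
    -- The parameter interval has measure one, so Cauchy–Schwarz costs no factor.
    refine (pow_le_pow_left' h1 2).trans ((sq_lintegral_le _ hm.aemeasurable).trans ?_)
    simp [mul_pow]
  have hm2 : Measurable fun q : E × ℝ => ‖fderiv ℝ u (q.1 + q.2 • h)‖ₑ ^ 2 * ‖h‖ₑ ^ 2 := by
    have : Continuous fun q : E × ℝ => fderiv ℝ u (q.1 + q.2 • h) := by fun_prop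
    exact ((this.enorm.measurable).pow_const 2).mul_const _
  calc ∫⁻ x, ‖u (x + h) - u x‖ₑ ^ 2 ∂μ
      ≤ ∫⁻ x, (∫⁻ t in Set.Icc (0 : ℝ) 1, ‖fderiv ℝ u (x + t • h)‖ₑ ^ 2 * ‖h‖ₑ ^ 2) ∂μ :=
        lintegral_mono hpt
    _ = ∫⁻ t in Set.Icc (0 : ℝ) 1, ∫⁻ x, ‖fderiv ℝ u (x + t • h)‖ₑ ^ 2 * ‖h‖ₑ ^ 2 ∂μ :=
        lintegral_lintegral_swap hm2.aemeasurable
    _ = ∫⁻ t in Set.Icc (0 : ℝ) 1, ‖h‖ₑ ^ 2 * ∫⁻ x, ‖fderiv ℝ u x‖ₑ ^ 2 ∂μ := by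
        -- By translation invariance the inner integral does not depend on `t`.
        refine lintegral_congr fun t => ?_
        rw [lintegral_add_right_eq_self (fun x => ‖fderiv ℝ u x‖ₑ ^ 2 * ‖h‖ₑ ^ 2),
          lintegral_mul_const _ (hcont.enorm.measurable.pow_const 2), mul_comm]
    _ = ‖h‖ₑ ^ 2 * ∫⁻ x, ‖fderiv ℝ u x‖ₑ ^ 2 ∂μ := by simp

/-- Comparison of a function with its integral over a ball. -/
theorem sq_enorm_mul_sq_measure_ball_le {u : E → ℝ} (hu : Continuous u) {c x : E} {r : ℝ}
    (hx : x ∈ Metric.ball c r) :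
    ‖u x‖ₑ ^ 2 * μ (Metric.ball c r) ^ 2 ≤
      2 * (μ (Metric.ball c r) * ∫⁻ h in Metric.ball 0 (2 * r), ‖u (x + h) - u x‖ₑ ^ 2 ∂μ)
        + 2 * ‖∫ y in Metric.ball c r, u y ∂μ‖ₑ ^ 2 := by
  have hfin : μ (Metric.ball c r) ≠ ⊤ := measure_ball_lt_top.ne
  have hint : IntegrableOn u (Metric.ball c r) μ :=
    (hu.continuousOn.integrableOn_compact (isCompact_closedBall c r)).mono_set
      Metric.ball_subset_closedBall
  have hconst : IntegrableOn (fun _ => u x) (Metric.ball c r) μ := integrableOn_const hfin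
  have h1 : u x * μ.real (Metric.ball c r)
      = (∫ y in Metric.ball c r, (u x - u y) ∂μ) + ∫ y in Metric.ball c r, u y ∂μ := by
    rw [integral_sub hconst hint]
    simp [mul_comm]
  have h2 : ‖u x‖ₑ * μ (Metric.ball c r) ≤ (∫⁻ y in Metric.ball c r, ‖u y - u x‖ₑ ∂μ)
      + ‖∫ y in Metric.ball c r, u y ∂μ‖ₑ := by
    have h3 : ‖u x‖ₑ * μ (Metric.ball c r) = ‖u x * μ.real (Metric.ball c r)‖ₑ := by
      rw [enorm_mul, Real.enorm_of_nonneg measureReal_nonneg, ofReal_measureReal hfin]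
    rw [h3, h1]
    refine (enorm_add_le _ _).trans (add_le_add_left ?_ _)
    refine (enorm_integral_le_lintegral_enorm _).trans (lintegral_mono fun y => ?_)
    rw [← enorm_neg, neg_sub]
  have h4 : (∫⁻ y in Metric.ball c r, ‖u y - u x‖ₑ ∂μ) ^ 2 ≤
      μ (Metric.ball c r) * ∫⁻ h in Metric.ball 0 (2 * r), ‖u (x + h) - u x‖ₑ ^ 2 ∂μ := by
    have hm : Measurable fun y => ‖u y - u x‖ₑ := (hu.sub continuous_const).enorm.measurable
    refine (sq_lintegral_le _ hm.aemeasurable).trans ?_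
    rw [Measure.restrict_apply_univ]
    refine mul_le_mul_right ?_ _
    -- Substitute `y = x + h`: since `x` lies in the ball of radius `r`, each such `h` has norm
    -- below `2r`.
    rw [← lintegral_indicator measurableSet_ball, ← lintegral_indicator measurableSet_ball,
      ← lintegral_add_left_eq_self _ x]
    refine lintegral_mono fun h => ?_
    by_cases hh : x + h ∈ Metric.ball c r
    · have : h ∈ Metric.ball (0 : E) (2 * r) := by
        rw [mem_ball_zero_iff]
        rw [Metric.mem_ball, dist_eq_norm] at hh hx
        calc ‖h‖ = ‖(x + h - c) - (x - c)‖ := by congr 1; abel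
          _ ≤ ‖x + h - c‖ + ‖x - c‖ := norm_sub_le _ _
          _ < 2 * r := by linarith
      rw [Set.indicator_of_mem hh, Set.indicator_of_mem this]
    · rw [Set.indicator_of_notMem hh]
      exact zero_le
  calc ‖u x‖ₑ ^ 2 * μ (Metric.ball c r) ^ 2 = (‖u x‖ₑ * μ (Metric.ball c r)) ^ 2 := by
        rw [mul_pow]
    _ ≤ _ := pow_le_pow_left' h2 2
    _ ≤ _ := add_sq_le_two_mul _ _
    _ ≤ _ := by gcongr

/-- On a set covered by finitely many balls of radius `r`, the `L²` norm of a `C¹` function is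
controlled by `r` times the `L²` norm of its derivative and by its integrals over the balls. -/
theorem lintegral_sq_le_of_subset_iUnion_ball {u : E → ℝ} (hu : ContDiff ℝ 1 u) {r : ℝ}
    (hr : 0 < r) {Ω : Set E} {t : Finset E} (hΩ : Ω ⊆ ⋃ c ∈ t, Metric.ball c r) :
    ∫⁻ x in Ω, ‖u x‖ₑ ^ 2 ∂μ ≤
      (2 ^ (Module.finrank ℝ E + 3) * ENNReal.ofReal r ^ 2) * ∫⁻ x, ‖fderiv ℝ u x‖ₑ ^ 2 ∂μ
      + (2 * μ Ω / μ (Metric.ball 0 r) ^ 2) *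
        ∑ c ∈ t, ‖∫ y in Metric.ball c r, u y ∂μ‖ₑ ^ 2 := by
  set B := μ (Metric.ball 0 r) with hB
  have hB0 : B ≠ 0 := (Metric.measure_ball_pos μ 0 hr).ne'
  have hBtop : B ≠ ⊤ := measure_ball_lt_top.ne
  set D := ∫⁻ x, ‖fderiv ℝ u x‖ₑ ^ 2 ∂μ
  set A := ∑ c ∈ t, ‖∫ y in Metric.ball c r, u y ∂μ‖ₑ ^ 2
  let g : E → ℝ≥0∞ := fun x => ∫⁻ h in Metric.ball 0 (2 * r), ‖u (x + h) - u x‖ₑ ^ 2 ∂μ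
  have hmeas : Measurable fun q : E × E => ‖u (q.1 + q.2) - u q.1‖ₑ ^ 2 := by
    have : Continuous fun q : E × E => u (q.1 + q.2) - u q.1 := by
      have := hu.continuous
      fun_prop
    exact this.enorm.measurable.pow_const 2
  have hgm : Measurable g := hmeas.lintegral_prod_right'
  have hpt : ∀ x ∈ Ω, ‖u x‖ₑ ^ 2 * B ^ 2 ≤ 2 * (B * g x) + 2 * A := by
    intro x hx
    obtain ⟨c, hc, hxc⟩ : ∃ c ∈ t, x ∈ Metric.ball c r := by simpa using hΩ hx
    have h := sq_enorm_mul_sq_measure_ball_le μ hu.continuous hxc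
    rw [Measure.addHaar_ball_center] at h
    refine h.trans (add_le_add_right (mul_le_mul_right ?_ _) _)
    exact Finset.single_le_sum (f := fun c => ‖∫ y in Metric.ball c r, u y ∂μ‖ₑ ^ 2)
      (fun _ _ => zero_le) hc
  have hg : ∫⁻ x, g x ∂μ ≤ (2 ^ Module.finrank ℝ E * B) * ((4 * ENNReal.ofReal r ^ 2) * D) := by
    have hball : μ (Metric.ball 0 (2 * r)) = 2 ^ Module.finrank ℝ E * B := by
      rw [Measure.addHaar_ball_mul_of_pos μ 0 two_pos, ENNReal.ofReal_pow zero_le_two]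
      simp [hB]
    calc ∫⁻ x, g x ∂μ
        = ∫⁻ h in Metric.ball 0 (2 * r), ∫⁻ x, ‖u (x + h) - u x‖ₑ ^ 2 ∂μ ∂μ :=
          lintegral_lintegral_swap hmeas.aemeasurable
      _ ≤ ∫⁻ h in Metric.ball (0 : E) (2 * r), (4 * ENNReal.ofReal r ^ 2) * D ∂μ := by
          refine setLIntegral_mono measurable_const fun h hh => ?_
          refine (lintegral_translate_sub_sq_le μ hu h).trans (mul_le_mul_left ?_ _)
          rw [mem_ball_zero_iff] at hh
          have h5 : ‖h‖ₑ ≤ ENNReal.ofReal (2 * r) := by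
            rw [← ofReal_norm]
            exact ENNReal.ofReal_le_ofReal hh.le
          refine (pow_le_pow_left' h5 2).trans_eq ?_
          rw [ENNReal.ofReal_mul zero_le_two, mul_pow]
          norm_num
      _ = _ := by rw [setLIntegral_const, hball, mul_comm]
  -- The exponent `finrank + 3` collects a factor `2` from squaring a sum, `2^finrank` from doubling
  -- the ball and `4` from `‖h‖ ≤ 2r`.
  have hmain : (∫⁻ x in Ω, ‖u x‖ₑ ^ 2 ∂μ) * B ^ 2 ≤
      (2 ^ (Module.finrank ℝ E + 3) * ENNReal.ofReal r ^ 2 * D) * B ^ 2 + 2 * μ Ω * A := by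
    calc (∫⁻ x in Ω, ‖u x‖ₑ ^ 2 ∂μ) * B ^ 2
        = ∫⁻ x in Ω, ‖u x‖ₑ ^ 2 * B ^ 2 ∂μ :=
          (lintegral_mul_const _ (hu.continuous.enorm.measurable.pow_const 2)).symm
      _ ≤ ∫⁻ x in Ω, (2 * (B * g x) + 2 * A) ∂μ :=
          setLIntegral_mono (((hgm.const_mul _).const_mul _).add_const _) hpt
      _ = 2 * (B * ∫⁻ x in Ω, g x ∂μ) + 2 * A * μ Ω := by
          rw [lintegral_add_right _ measurable_const, lintegral_const_mul _ (hgm.const_mul _),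
            lintegral_const_mul _ hgm, setLIntegral_const]
      _ ≤ 2 * (B * ((2 ^ Module.finrank ℝ E * B) * ((4 * ENNReal.ofReal r ^ 2) * D)))
          + 2 * A * μ Ω := by
          gcongr
          exact (setLIntegral_le_lintegral _ _).trans hg
      _ = _ := by ring
  have hB2 : B ^ 2 ≠ 0 := pow_ne_zero 2 hB0
  have hB2' : B ^ 2 ≠ ⊤ := ENNReal.pow_ne_top hBtop
  rw [← ENNReal.mul_le_mul_iff_left hB2 hB2']
  refine hmain.trans_eq ?_
  rw [add_mul]
  congr 1
  rw [mul_right_comm (2 * μ Ω / B ^ 2), ENNReal.div_mul_cancel hB2 hB2']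

end Translation

/-! ### Sobolev inequalities on bounded sets -/

/-- On the line, a `C¹` function with compact support is bounded by the `L¹` norm of its
derivative. -/
theorem enorm_le_lintegral_fderiv_of_dim_one {u : EuclideanSpace ℝ (Fin 1) → ℝ}
    (hu : ContDiff ℝ 1 u) (hc : HasCompactSupport u) (x : EuclideanSpace ℝ (Fin 1)) :
    ‖u x‖ₑ ≤ ∫⁻ y, ‖fderiv ℝ u y‖ₑ := by
  let e : EuclideanSpace ℝ (Fin 1) := EuclideanSpace.single 0 1
  have he : ‖e‖ = 1 := by simp [e]
  obtain ⟨R, hR⟩ := hc.isCompact.isBounded.subset_closedBall 0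
  -- Long enough a step that `x + a • e` leaves the support.
  let a : ℝ := |R| + ‖x‖ + 1
  have ha : 0 ≤ a := by positivity
  have hzero : u (x + a • e) = 0 := by
    by_contra hne
    have h1 := hR (subset_tsupport _ hne)
    rw [mem_closedBall_zero_iff] at h1
    have h2 : ‖a • e‖ ≤ ‖x + a • e‖ + ‖x‖ := by
      simpa using norm_sub_le (x + a • e) x
    rw [norm_smul, he, mul_one, Real.norm_of_nonneg ha] at h2
    have := le_abs_self R
    simp only [a] at h2 h1
    linarith
  have h1 := enorm_add_sub_le_lintegral hu x e ha
  rw [hzero, zero_sub, enorm_neg] at h1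
  have hen : ‖e‖ₑ = 1 := by rw [← ofReal_norm, he]; simp
  simp only [hen, mul_one] at h1
  have hmp : MeasurePreserving (fun t : ℝ => t • e) := by
    have h2 := ((volume_preserving_funUnique (Fin 1) ℝ).symm).trans
      (EuclideanSpace.volume_preserving_symm_measurableEquiv_toLp (Fin 1)).symm
    convert! h2 using 1
    funext t
    ext i
    fin_cases i
    simp [e]
  have hmp' : MeasurePreserving (fun t : ℝ => x + t • e) :=
    (measurePreserving_add_left volume x).comp hmp
  refine h1.trans ((setLIntegral_le_lintegral _ _).trans_eq ?_)
  exact hmp'.lintegral_comp (hu.continuous_fderiv one_ne_zero).enorm.measurable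

/-- On functions supported in a bounded set, the `L²` norm dominates the `Lʳ` norms with
`r ≤ 2`. -/
theorem exists_eLpNorm_le_eLpNorm_two {d : ℕ} {F : Type*} [NormedAddCommGroup F]
    {s : Set (EuclideanSpace ℝ (Fin d))} (hs : Bornology.IsBounded s) {r : ℝ≥0} (hr1 : 1 ≤ r)
    (hr2 : r ≤ 2) :
    ∃ C : ℝ≥0, ∀ g : EuclideanSpace ℝ (Fin d) → F, AEStronglyMeasurable g volume →
      g.support ⊆ s → eLpNorm g r volume ≤ C * eLpNorm g 2 volume := by
  have hexp : 0 ≤ 1 / (r : ℝ≥0∞).toReal - 1 / (2 : ℝ≥0∞).toReal := by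
    have : (r : ℝ) ≤ 2 := by exact_mod_cast hr2
    have : (0 : ℝ) < r := lt_of_lt_of_le zero_lt_one (by exact_mod_cast hr1)
    simp only [ENNReal.coe_toReal, ENNReal.toReal_ofNat, sub_nonneg]
    gcongr
  refine ⟨(volume s ^ (1 / (r : ℝ≥0∞).toReal - 1 / (2 : ℝ≥0∞).toReal)).toNNReal,
    fun g hg hsupp => ?_⟩
  rw [ENNReal.coe_toNNReal (ENNReal.rpow_ne_top_of_nonneg hexp hs.measure_lt_top.ne),
    ← eLpNorm_restrict_eq_of_support_subset hsupp,
    ← eLpNorm_restrict_eq_of_support_subset (p := 2) hsupp, mul_comm]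
  refine (eLpNorm_le_eLpNorm_mul_rpow_measure_univ (q := 2) (by exact_mod_cast hr2)
    hg.restrict).trans_eq ?_
  rw [Measure.restrict_apply_univ]

/-- The Sobolev inequality for functions supported in a bounded set, with the `L²` norm of the
derivative on the right-hand side, for all exponents up to the critical one. -/
theorem exists_eLpNorm_le_eLpNorm_fderiv_two {d : ℕ} (hd : 1 ≤ d)
    {s : Set (EuclideanSpace ℝ (Fin d))} (hs : Bornology.IsBounded s) {q : ℝ≥0} (hq : 2 ≤ q)
    (hdq : 3 ≤ d → (2 : ℝ)⁻¹ - (d : ℝ)⁻¹ ≤ (q : ℝ)⁻¹) :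
    ∃ C : ℝ≥0, ∀ u : EuclideanSpace ℝ (Fin d) → ℝ, ContDiff ℝ 1 u → u.support ⊆ s →
      eLpNorm u q volume ≤ C * eLpNorm (fderiv ℝ u) 2 volume := by
  -- Any derivative exponent `r ≤ 2` suffices, since bounded support raises it to `2`.
  suffices h : ∃ (r : ℝ≥0) (C : ℝ≥0), 1 ≤ r ∧ r ≤ 2 ∧
      ∀ u : EuclideanSpace ℝ (Fin d) → ℝ, ContDiff ℝ 1 u → u.support ⊆ s →
        eLpNorm u q volume ≤ C * eLpNorm (fderiv ℝ u) r volume by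
    obtain ⟨r, C, hr1, hr2, h⟩ := h
    obtain ⟨C', h'⟩ := exists_eLpNorm_le_eLpNorm_two
      (F := EuclideanSpace ℝ (Fin d) →L[ℝ] ℝ) hs.closure hr1 hr2
    refine ⟨C * C', fun u hu hsupp => (h u hu hsupp).trans ?_⟩
    rw [ENNReal.coe_mul, mul_assoc]
    refine mul_le_mul_right (h' _ (hu.continuous_fderiv one_ne_zero).aestronglyMeasurable ?_) _
    exact (support_fderiv_subset ℝ).trans (closure_mono hsupp)
  have hfin : Module.finrank ℝ (EuclideanSpace ℝ (Fin d)) = d := by simp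
  have hq0 : (0 : ℝ) < q := lt_of_lt_of_le zero_lt_two (by exact_mod_cast hq)
  have hq2 : (2 : ℝ) ≤ q := by exact_mod_cast hq
  rcases lt_or_ge d 3 with hd3 | hd3
  · interval_cases d
    · refine ⟨1, (volume (closure s) ^ (q : ℝ)⁻¹).toNNReal, le_rfl, one_le_two,
        fun u hu hsupp => ?_⟩
      have hcs : HasCompactSupport u :=
        HasCompactSupport.of_support_subset_isCompact hs.isCompact_closure
          (hsupp.trans subset_closure)
      have hKfin : volume (closure s) ≠ ⊤ := hs.closure.measure_lt_top.ne
      rw [ENNReal.coe_toNNReal (ENNReal.rpow_ne_top_of_nonneg (by positivity) hKfin),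
        ← eLpNorm_restrict_eq_of_support_subset (hsupp.trans subset_closure), ENNReal.coe_one,
        eLpNorm_one_eq_lintegral_enorm]
      have hb := eLpNorm_le_of_ae_enorm_bound (p := q) (μ := volume.restrict (closure s))
        (Eventually.of_forall (enorm_le_lintegral_fderiv_of_dim_one hu hcs))
      simpa [mul_comm] using hb
    -- In the plane, `2q/(q+2)` is the exponent whose Sobolev conjugate is `q`: `1/r - 1/2 = 1/q`.
    · have hr : ((2 * q / (q + 2) : ℝ≥0) : ℝ) = 2 * q / (q + 2) := by push_cast; rfl
      have hr1 : (1 : ℝ≥0) ≤ 2 * q / (q + 2) := by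
        rw [← NNReal.coe_le_coe, hr, NNReal.coe_one, le_div_iff₀ (by positivity)]
        linarith
      have hr2 : (2 * q / (q + 2) : ℝ≥0) < 2 := by
        rw [← NNReal.coe_lt_coe, hr, NNReal.coe_ofNat, div_lt_iff₀ (by positivity)]
        linarith
      refine ⟨2 * q / (q + 2), _, hr1, hr2.le, fun u hu hsupp =>
        eLpNorm_le_eLpNorm_fderiv_of_le volume hu hsupp hr1 (by rw [hfin]; exact_mod_cast hr2)
          ?_ hs⟩
      rw [NNReal.coe_inv, hr, hfin]
      apply le_of_eq
      field_simp
      push_cast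
      ring
  · refine ⟨2, _, one_le_two, le_rfl, fun u hu hsupp =>
      eLpNorm_le_eLpNorm_fderiv_of_le volume hu hsupp one_le_two
        (by rw [hfin]; exact_mod_cast hd3) ?_ hs⟩
    rw [hfin]
    exact hdq hd3

/-! ### Embedding, compactness and dimension of `H¹₀` -/

section Sobolev

variable {d : ℕ} {Ω : Set (EuclideanSpace ℝ (Fin d))}

theorem sq_eLpNorm_two {α F : Type*} [MeasurableSpace α] [NormedAddCommGroup F] (μ : Measure α)
    (f : α → F) : eLpNorm f 2 μ ^ 2 = ∫⁻ x, ‖f x‖ₑ ^ 2 ∂μ := by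
  simpa using eLpNorm_nnreal_pow_eq_lintegral (μ := μ) (f := f) (p := 2) two_ne_zero

theorem enorm_gradient (u : EuclideanSpace ℝ (Fin d) → ℝ) (x : EuclideanSpace ℝ (Fin d)) :
    ‖gradient u x‖ₑ = ‖fderiv ℝ u x‖ₑ := by
  rw [← ofReal_norm, ← ofReal_norm, gradient, LinearIsometryEquiv.norm_map]

theorem enorm_eq_eLpNorm_of_ae_eq {F : Type*} [NormedAddCommGroup F]
    {μ : Measure (EuclideanSpace ℝ (Fin d))} {f : Lp F 2 μ} {g : EuclideanSpace ℝ (Fin d) → F}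
    (h : f =ᵐ[μ] g) : ‖f‖ₑ = eLpNorm g 2 μ := by
  rw [Lp.enorm_def, eLpNorm_congr_ae h]

theorem support_subset_of_tsupport_subset {u : EuclideanSpace ℝ (Fin d) → ℝ}
    (hu : tsupport u ⊆ Ω) : u.support ⊆ Ω :=
  (subset_tsupport u).trans hu

theorem eLpNorm_restrict_of_support_subset {F : Type*} [NormedAddCommGroup F] (q : ℝ≥0∞)
    {g : EuclideanSpace ℝ (Fin d) → F} (hg : g.support ⊆ Ω) :
    eLpNorm g q (volume.restrict Ω) = eLpNorm g q volume :=
  eLpNorm_restrict_eq_of_support_subset hg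

/-- The gradient of a test function, as an element of `L²(Ω)`, has the norm of the derivative on
the whole space. -/
theorem enorm_snd_of_testPair {w : PairSpace Ω} {u : EuclideanSpace ℝ (Fin d) → ℝ}
    (hu : tsupport u ⊆ Ω) (hw : w.snd =ᵐ[volume.restrict Ω] gradient u) :
    ‖w.snd‖ₑ = eLpNorm (fderiv ℝ u) 2 volume := by
  have h1 : (fderiv ℝ u).support ⊆ Ω := (support_fderiv_subset ℝ).trans hu
  have h2 : eLpNorm (gradient u) 2 (volume.restrict Ω)
      = eLpNorm (fderiv ℝ u) 2 (volume.restrict Ω) :=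
    eLpNorm_congr_enorm_ae (Eventually.of_forall (enorm_gradient u))
  rw [enorm_eq_eLpNorm_of_ae_eq hw, h2]
  exact eLpNorm_restrict_of_support_subset _ h1

/-- The inclusion of `H¹₀(Ω)` in `L²(Ω)`. -/
def toL2 (Ω : Set (EuclideanSpace ℝ (Fin d))) : H10 Ω →L[ℝ] Lp ℝ 2 (volume.restrict Ω) :=
  WithLp.fstL 2 ℝ _ _ ∘L (testPairs Ω).topologicalClosure.subtypeL

theorem norm_fst_le (w : PairSpace Ω) : ‖w.fst‖ ≤ ‖w‖ := by
  have := WithLp.prod_norm_sq_eq_of_L2 w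
  exact le_of_sq_le_sq (by nlinarith [sq_nonneg ‖w.snd‖]) (norm_nonneg _)

theorem norm_snd_le (w : PairSpace Ω) : ‖w.snd‖ ≤ ‖w‖ := by
  have := WithLp.prod_norm_sq_eq_of_L2 w
  exact le_of_sq_le_sq (by nlinarith [sq_nonneg ‖w.fst‖]) (norm_nonneg _)

/-- The Sobolev inequality in `H¹₀(Ω)`. -/
theorem exists_eLpNorm_val_le (hd : 1 ≤ d) (hΩ : Bornology.IsBounded Ω) {q : ℝ≥0} (hq : 2 ≤ q)
    (hdq : 3 ≤ d → (2 : ℝ)⁻¹ - (d : ℝ)⁻¹ ≤ (q : ℝ)⁻¹) :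
    ∃ C : ℝ≥0, ∀ u : H10 Ω, eLpNorm u.val q (volume.restrict Ω) ≤ C * ‖u‖ₑ := by
  obtain ⟨C, hC⟩ := exists_eLpNorm_le_eLpNorm_fderiv_two hd hΩ hq hdq
  have htest : ∀ w ∈ testPairs Ω, eLpNorm w.fst q (volume.restrict Ω) ≤ C * ‖w‖ₑ := by
    rintro w ⟨u, hu, -, hsupp, hfst, hsnd⟩
    rw [eLpNorm_congr_ae hfst,
      eLpNorm_restrict_eq_of_support_subset (support_subset_of_tsupport_subset hsupp)]
    refine (hC u (hu.of_le (by simp)) (support_subset_of_tsupport_subset hsupp)).trans ?_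
    rw [← enorm_snd_of_testPair hsupp hsnd]
    refine mul_le_mul_right ?_ _
    exact enorm_le_iff_norm_le.2 (norm_snd_le w)
  refine ⟨C, fun u => ?_⟩
  obtain ⟨w, hw, hlim⟩ := mem_closure_iff_seq_limit.1 u.2
  have hfst : Tendsto (fun n => (w n).fst) atTop (𝓝 (u : PairSpace Ω).fst) :=
    ((WithLp.fstL 2 ℝ _ _).continuous.tendsto _).comp hlim
  -- Convergence holds only in `L²`, while `q` may exceed `2`. An a.e. convergent subsequence and
  -- Fatou's lemma carry the bound to the limit.
  obtain ⟨ns, hns, hae⟩ := (tendstoInMeasure_of_tendsto_Lp hfst).exists_seq_tendsto_ae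
  refine (Lp.eLpNorm_lim_le_liminf_eLpNorm (fun n => Lp.aestronglyMeasurable _) _ hae).trans ?_
  have hnorm : Tendsto (fun n => (C : ℝ≥0∞) * ‖w (ns n)‖ₑ) atTop (𝓝 (C * ‖u‖ₑ)) :=
    ENNReal.Tendsto.const_mul
      ((continuous_enorm.tendsto _).comp (hlim.comp hns.tendsto_atTop)) (Or.inr ENNReal.coe_ne_top)
  rw [← hnorm.liminf_eq]
  exact liminf_le_liminf (Eventually.of_forall fun n => htest _ (hw (ns n)))

/-- Quantitative form of the Rellich theorem: the `L²` norm is controlled by a small multiple of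
the `H¹` norm and the integrals over finitely many balls. -/
theorem sq_norm_fst_le_of_subset_iUnion_ball {r : ℝ}
    (hr : 0 < r) {t : Finset (EuclideanSpace ℝ (Fin d))} (hΩfin : volume Ω ≠ ⊤)
    (hΩ : Ω ⊆ ⋃ c ∈ t, Metric.ball c r) (u : H10 Ω) :
    ‖toL2 Ω u‖ ^ 2 ≤ (2 ^ (d + 3) * r ^ 2) * ‖u‖ ^ 2 +
      (2 * volume Ω / volume (Metric.ball (0 : EuclideanSpace ℝ (Fin d)) r) ^ 2).toReal *
        ∑ c ∈ t, (∫ x in Metric.ball c r, toL2 Ω u x ∂(volume.restrict Ω)) ^ 2 := by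
  set K := 2 * volume Ω / volume (Metric.ball (0 : EuclideanSpace ℝ (Fin d)) r) ^ 2 with hK
  have hKtop : K ≠ ⊤ := ENNReal.div_ne_top (ENNReal.mul_ne_top (by simp) hΩfin)
    (pow_ne_zero 2 (Metric.measure_ball_pos volume 0 hr).ne')
  have hball : ∀ c : EuclideanSpace ℝ (Fin d), (volume.restrict Ω) (Metric.ball c r) ≠ ⊤ :=
    fun c => ((Measure.restrict_apply_le _ _).trans_lt measure_ball_lt_top).ne
  let I : EuclideanSpace ℝ (Fin d) → PairSpace Ω → ℝ := fun c w =>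
    ∫ x in Metric.ball c r, w.fst x ∂(volume.restrict Ω)
  have hIcont : ∀ c, Continuous (I c) := by
    intro c
    have h : I c = fun w => inner ℝ (indicatorConstLp 2 measurableSet_ball (hball c) (1 : ℝ))
        w.fst := by
      funext w
      rw [L2.inner_indicatorConstLp_one]
    rw [h]
    exact continuous_const.inner (WithLp.fstL 2 ℝ _ _).continuous
  let P : Set (PairSpace Ω) := {w | ‖w.fst‖ ^ 2 ≤ (2 ^ (d + 3) * r ^ 2) * ‖w‖ ^ 2 +
    K.toReal * ∑ c ∈ t, I c w ^ 2}
  -- Ball integrals are `L²` pairings with indicators, hence continuous, so the inequality need only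
  -- be checked on test functions.
  have hPclosed : IsClosed P := by
    refine isClosed_le ((WithLp.fstL 2 ℝ _ _).continuous.norm.pow 2) ?_
    exact (continuous_const.mul (continuous_norm.pow 2)).add
      (continuous_const.mul (continuous_finsetSum _ fun c _ => (hIcont c).pow 2))
  suffices h : (testPairs Ω : Set (PairSpace Ω)) ⊆ P from closure_minimal h hPclosed u.2
  rintro w ⟨v, hv, -, hsupp, hfst, hsnd⟩
  have hI : ∀ c, ∫ y in Metric.ball c r, v y = I c w := by
    intro c
    have h1 : I c w = ∫ x in Metric.ball c r, v x ∂(volume.restrict Ω) :=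
      integral_congr_ae (ae_restrict_of_ae hfst)
    rw [h1, Measure.restrict_restrict measurableSet_ball]
    refine setIntegral_eq_of_subset_of_forall_sdiff_eq_zero measurableSet_ball
      Set.inter_subset_left fun x hx => ?_
    by_contra hne
    exact hx.2 ⟨hx.1, support_subset_of_tsupport_subset hsupp hne⟩
  have hmain := lintegral_sq_le_of_subset_iUnion_ball volume (hv.of_le (by simp)) hr hΩ
  rw [← sq_eLpNorm_two, ← sq_eLpNorm_two, ← enorm_snd_of_testPair hsupp hsnd,
    ← enorm_eq_eLpNorm_of_ae_eq hfst, ← hK] at hmain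
  simp only [hI, finrank_euclideanSpace, Fintype.card_fin] at hmain
  have hA : (2 ^ (d + 3) * ENNReal.ofReal r ^ 2) * ‖w.snd‖ₑ ^ 2 ≠ ⊤ := by finiteness
  have hB : K * ∑ c ∈ t, ‖I c w‖ₑ ^ 2 ≠ ⊤ :=
    ENNReal.mul_ne_top hKtop (ENNReal.sum_ne_top.2 fun c _ => by finiteness)
  have hreal := ENNReal.toReal_mono (ENNReal.add_ne_top.2 ⟨hA, hB⟩) hmain
  rw [ENNReal.toReal_add hA hB, ENNReal.toReal_mul, ENNReal.toReal_mul, ENNReal.toReal_mul,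
    ENNReal.toReal_sum (fun c _ => by finiteness)] at hreal
  simp only [ENNReal.toReal_pow, toReal_enorm, ENNReal.toReal_ofReal hr.le, ENNReal.toReal_ofNat,
    Real.norm_eq_abs, sq_abs] at hreal
  refine hreal.trans (add_le_add_left ?_ _)
  have := norm_snd_le w
  gcongr

/-- The **Rellich theorem**: the `L²` norm is small compared with the `H¹` norm on a subspace of
`H¹₀(Ω)` of finite codimension. -/
theorem exists_finiteDimensional_norm_toL2_le (hΩ : Bornology.IsBounded Ω) {ε : ℝ} (hε : 0 < ε) :
    ∃ W : Submodule ℝ (H10 Ω), FiniteDimensional ℝ W ∧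
      ∀ u ∈ Wᗮ, ‖toL2 Ω u‖ ≤ ε * ‖u‖ := by
  -- With `r = ε / D` the coefficient `2^(d+3) r²` is exactly `ε²`.
  let D : ℝ := Real.sqrt (2 ^ (d + 3))
  have hD : 0 < D := by positivity
  have hr : 0 < ε / D := by positivity
  obtain ⟨t, ht, hcov⟩ := Metric.totallyBounded_iff.1
    (hΩ.isCompact_closure.totallyBounded.subset subset_closure) (ε / D) hr
  have hball : ∀ c : EuclideanSpace ℝ (Fin d),
      (volume.restrict Ω) (Metric.ball c (ε / D)) ≠ ⊤ :=
    fun c => ((Measure.restrict_apply_le _ _).trans_lt measure_ball_lt_top).ne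
  -- Riesz representatives of the ball integrals; on their orthogonal complement only the `ε` term
  -- survives.
  let e : EuclideanSpace ℝ (Fin d) → H10 Ω := fun c => ContinuousLinearMap.adjoint (toL2 Ω)
    (indicatorConstLp 2 measurableSet_ball (hball c) (1 : ℝ))
  refine ⟨Submodule.span ℝ (e '' t), FiniteDimensional.span_of_finite ℝ (ht.image e),
    fun u hu => ?_⟩
  have h0 : ∀ c ∈ t,
      ∫ x in Metric.ball c (ε / D), toL2 Ω u x ∂(volume.restrict Ω) = 0 := by
    intro c hc
    rw [← L2.inner_indicatorConstLp_one measurableSet_ball (hball c),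
      ← ContinuousLinearMap.adjoint_inner_left]
    exact (Submodule.mem_orthogonal _ _).1 hu _ (Submodule.subset_span ⟨c, hc, rfl⟩)
  have h := sq_norm_fst_le_of_subset_iUnion_ball hr (t := ht.toFinset)
    hΩ.measure_lt_top.ne (by simpa using hcov) u
  rw [Finset.sum_eq_zero (fun c hc => by rw [h0 c (by simpa using hc)]; simp), mul_zero,
    add_zero, div_pow, Real.sq_sqrt (by positivity), mul_div_cancel₀ _ (by positivity),
    ← mul_pow] at h
  exact le_of_sq_le_sq h (by positivity)

theorem separableSpace_H10 (Ω : Set (EuclideanSpace ℝ (Fin d))) :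
    TopologicalSpace.SeparableSpace (H10 Ω) := by
  have : Fact ((2 : ℝ≥0∞) ≠ ⊤) := ⟨by simp⟩
  have h1 : SecondCountableTopology (Lp ℝ 2 (volume.restrict Ω)) := inferInstance
  have h2 : SecondCountableTopology (Lp (EuclideanSpace ℝ (Fin d)) 2 (volume.restrict Ω)) :=
    inferInstance
  have h3 : SecondCountableTopology (PairSpace Ω) := inferInstance
  have h4 : SecondCountableTopology (H10 Ω) :=
    TopologicalSpace.Subtype.secondCountableTopology _
  infer_instance

/-- Every test function defines an element of `H¹₀(Ω)`. -/
theorem exists_H10_of_contDiff {u : EuclideanSpace ℝ (Fin d) → ℝ} (hu : ContDiff ℝ ∞ u)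
    (hc : HasCompactSupport u) (hsupp : tsupport u ⊆ Ω) :
    ∃ w : H10 Ω, w.val =ᵐ[volume.restrict Ω] u ∧ w.grad =ᵐ[volume.restrict Ω] gradient u := by
  have hu2 : MemLp u 2 (volume.restrict Ω) :=
    (hu.continuous.memLp_of_hasCompactSupport hc).restrict Ω
  have hgc : Continuous (gradient u) :=
    (InnerProductSpace.toDual ℝ _).symm.continuous.comp (hu.continuous_fderiv (by simp))
  have hgs : HasCompactSupport (gradient u) :=
    (hc.fderiv ℝ).comp_left (map_zero (InnerProductSpace.toDual ℝ _).symm)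
  have hg2 : MemLp (gradient u) 2 (volume.restrict Ω) :=
    (hgc.memLp_of_hasCompactSupport hgs).restrict Ω
  refine ⟨⟨WithLp.toLp 2 (hu2.toLp u, hg2.toLp _), subset_closure
    ⟨u, hu, hc, hsupp, hu2.coeFn_toLp, hg2.coeFn_toLp⟩⟩, hu2.coeFn_toLp, hg2.coeFn_toLp⟩

/-- `H¹₀(Ω)` is infinite-dimensional if `Ω` is a nonempty open set in positive dimension. -/
theorem not_finiteDimensional_H10 (hd : 1 ≤ d) (hΩ : IsOpen Ω) (hne : Ω.Nonempty) :
    ¬ FiniteDimensional ℝ (H10 Ω) := by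
  intro hfin
  have : NeZero d := ⟨by omega⟩
  have : Infinite Ω := by
    obtain ⟨x, hx⟩ := hne
    exact (infinite_of_mem_nhds x (hΩ.mem_nhds hx)).to_subtype
  -- Bumps in disjoint open sets are orthogonal, as at each point one of any two vanishes with its
  -- gradient.
  obtain ⟨U, hUinf, hUopen, hUdisj⟩ := exists_seq_infinite_isOpen_pairwise_disjoint Ω
  choose x hx using fun n => (hUinf n).nonempty
  let V : ℕ → Set (EuclideanSpace ℝ (Fin d)) := fun n => Subtype.val '' U n
  have hVopen : ∀ n, IsOpen (V n) := fun n => hΩ.isOpenMap_subtype_val _ (hUopen n)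
  have hVΩ : ∀ n, V n ⊆ Ω := fun n => by
    rintro _ ⟨y, -, rfl⟩
    exact y.2
  choose f hfV hfc hfd _ hf1 using fun n => exists_contDiff_tsupport_subset (n := ⊤)
    ((hVopen n).mem_nhds ⟨x n, hx n, rfl⟩)
  choose w hw hwg using fun n => exists_H10_of_contDiff (hfd n) (hfc n) ((hfV n).trans (hVΩ n))
  have hw0 : ∀ n, w n ≠ 0 := by
    intro n h0
    have h1 : f n =ᵐ[volume.restrict Ω] 0 := by
      refine (hw n).symm.trans ?_
      rw [h0]
      exact Lp.coeFn_zero _ _ _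
    have h2 := Measure.eqOn_open_of_ae_eq h1 hΩ (hfd n).continuous.continuousOn
      continuousOn_const
    have h3 := h2 (x n).2
    rw [hf1] at h3
    exact one_ne_zero h3
  have horth : Pairwise fun m n => inner ℝ (w m) (w n) = 0 := by
    intro m n hmn
    have hdis : Disjoint (V m) (V n) := by
      exact Set.disjoint_image_of_injective Subtype.val_injective (hUdisj hmn)
    rw [H10.inner_eq]
    refine integral_eq_zero_of_ae ?_
    filter_upwards [hw m, hw n, hwg m, hwg n] with y h1 h2 h3 h4
    rw [h1, h2, h3, h4]
    by_cases hy : y ∈ tsupport (f m)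
    · have hy' : y ∉ tsupport (f n) := fun h => hdis.notMem_of_mem_left (hfV m hy) (hfV n h)
      have hg : gradient (f n) y = 0 := by
        simp [gradient, fderiv_of_notMem_tsupport ℝ hy']
      simp [image_eq_zero_of_notMem_tsupport hy', hg]
    · have hg : gradient (f m) y = 0 := by
        simp [gradient, fderiv_of_notMem_tsupport ℝ hy]
      simp [image_eq_zero_of_notMem_tsupport hy, hg]
  have hli := linearIndependent_of_ne_zero_of_inner_eq_zero (𝕜 := ℝ) hw0 horth
  exact not_finite_iff_infinite.2 inferInstance hli.finite

end Sobolev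

/-! ### Hölder's inequality for the potential -/

/-- Hölder's inequality for a product `|f|^(p-1) u²` with both functions in `L^(p+1)`. -/
theorem lintegral_rpow_mul_sq_le {α : Type*} [MeasurableSpace α] (μ : Measure α) {p : ℝ}
    (hp : 1 < p) {q : ℝ≥0} (hq : (q : ℝ) = p + 1) {f u : α → ℝ}
    (hf : AEStronglyMeasurable f μ) (hu : AEStronglyMeasurable u μ) :
    ∫⁻ x, ‖f x‖ₑ ^ (p - 1) * ‖u x‖ₑ ^ 2 ∂μ ≤ eLpNorm f q μ ^ (p - 1) * eLpNorm u q μ ^ 2 := by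
  have hq0 : q ≠ 0 := by
    rintro rfl
    simp at hq
    linarith
  have hp1 : 0 < p - 1 := by linarith
  have hp2 : 0 < p + 1 := by linarith
  have hconj : ((p + 1) / (p - 1)).HolderConjugate ((p + 1) / 2) := by
    rw [Real.holderConjugate_iff]
    constructor
    · rw [lt_div_iff₀ hp1]; linarith
    · field_simp; ring
  have h := ENNReal.lintegral_mul_le_Lp_mul_Lq μ hconj
    (f := fun x => ‖f x‖ₑ ^ (p - 1)) (g := fun x => ‖u x‖ₑ ^ 2)
    (hf.enorm.pow_const _) (hu.enorm.pow_const _)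
  refine h.trans_eq ?_
  have h1 : ∀ x, (‖f x‖ₑ ^ (p - 1)) ^ ((p + 1) / (p - 1)) = ‖f x‖ₑ ^ (q : ℝ) := fun x => by
    rw [← ENNReal.rpow_mul, hq]; congr 1; field_simp
  have h2 : ∀ x, (‖u x‖ₑ ^ 2) ^ ((p + 1) / 2) = ‖u x‖ₑ ^ (q : ℝ) := fun x => by
    rw [← ENNReal.rpow_natCast, ← ENNReal.rpow_mul, hq]; congr 1; push_cast; field_simp
  simp only [h1, h2]
  rw [← eLpNorm_nnreal_pow_eq_lintegral hq0, ← eLpNorm_nnreal_pow_eq_lintegral hq0,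
    ← ENNReal.rpow_mul, ← ENNReal.rpow_mul, ← ENNReal.rpow_natCast, hq]
  congr 2
  · field_simp
  · push_cast; field_simp

/-! ### The potential and the linearized operator -/

section Linearization

variable {d : ℕ} {Ω : Set (EuclideanSpace ℝ (Fin d))}

theorem aestronglyMeasurable_val (u : H10 Ω) :
    AEStronglyMeasurable u.val (volume.restrict Ω) :=
  Lp.aestronglyMeasurable _

/-- The square root of the potential `p |φ|^(p-1)`. -/
def sqrtPotential (p : ℝ) (φ : H10 Ω) (x : EuclideanSpace ℝ (Fin d)) : ℝ :=
  Real.sqrt (p * |φ.val x| ^ (p - 1))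

theorem sqrtPotential_mul_self {p : ℝ} (hp : 0 ≤ p) (φ : H10 Ω)
    (x : EuclideanSpace ℝ (Fin d)) :
    sqrtPotential p φ x * sqrtPotential p φ x = p * |φ.val x| ^ (p - 1) :=
  Real.mul_self_sqrt (by positivity)

theorem aestronglyMeasurable_sqrtPotential_mul (p : ℝ) (φ u : H10 Ω) :
    AEStronglyMeasurable (fun x => sqrtPotential p φ x * u.val x) (volume.restrict Ω) := by
  refine AEStronglyMeasurable.mul ?_ (aestronglyMeasurable_val u)
  have h := (aestronglyMeasurable_val φ).aemeasurable
  exact (((h.abs.pow_const (p - 1)).const_mul p).sqrt).aestronglyMeasurable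

theorem enorm_sqrtPotential_mul_sq {p : ℝ} (hp : 1 < p) (φ u : H10 Ω)
    (x : EuclideanSpace ℝ (Fin d)) :
    ‖sqrtPotential p φ x * u.val x‖ₑ ^ 2
      = ENNReal.ofReal p * (‖φ.val x‖ₑ ^ (p - 1) * ‖u.val x‖ₑ ^ 2) := by
  have h1 : ‖sqrtPotential p φ x‖ₑ ^ 2 = ENNReal.ofReal p * ‖φ.val x‖ₑ ^ (p - 1) := by
    rw [← enorm_pow, pow_two, sqrtPotential_mul_self (by linarith), enorm_mul,
      Real.enorm_of_nonneg (by linarith), Real.enorm_of_nonneg (by positivity),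
      ← ENNReal.ofReal_rpow_of_nonneg (abs_nonneg _) (by linarith), ← Real.norm_eq_abs,
      ofReal_norm]
  rw [enorm_mul, mul_pow, h1, mul_assoc]

/-- For `d ≥ 3`, subcriticality is equivalent to `p + 1 < 2d/(d-2)`, so the Sobolev embedding
reaches the exponent required by Hölder. -/
theorem two_le_add_one_and_le_inv {p : ℝ} (hp : Subcritical d p) {q : ℝ≥0}
    (hq : (q : ℝ) = p + 1) :
    2 ≤ q ∧ (3 ≤ d → (2 : ℝ)⁻¹ - (d : ℝ)⁻¹ ≤ (q : ℝ)⁻¹) := by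
  constructor
  · rw [← NNReal.coe_le_coe, hq]
    have := hp.1
    push_cast
    linarith
  · intro hd
    have hd' : (3 : ℝ) ≤ d := by exact_mod_cast hd
    have h1 := hp.2 hd
    rw [lt_div_iff₀ (by linarith)] at h1
    have h2 := hp.1
    rw [hq, inv_sub_inv two_ne_zero (by positivity), inv_eq_one_div, div_le_div_iff₀
      (by positivity) (by linarith)]
    nlinarith

/-- The estimate that controls multiplication by the square root of the potential, split
according to the size of `φ`. -/
theorem exists_sq_eLpNorm_sqrtPotential_mul_le (hd : 1 ≤ d) (hΩ : Bornology.IsBounded Ω) {p : ℝ}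
    (hp : Subcritical d p) (φ : H10 Ω) {ε : ℝ≥0} (hε : 0 < ε) :
    ∃ A : ℝ≥0, ∀ u : H10 Ω,
      eLpNorm (fun x => sqrtPotential p φ x * u.val x) 2 (volume.restrict Ω) ^ 2
        ≤ A * ‖toL2 Ω u‖ₑ ^ 2 + ε * ‖u‖ₑ ^ 2 := by
  have hp1 : 0 < p - 1 := by linarith [hp.1]
  have hp0 : 0 < p := by linarith
  obtain ⟨q, hq⟩ : ∃ q : ℝ≥0, (q : ℝ) = p + 1 := ⟨⟨p + 1, by linarith⟩, rfl⟩
  obtain ⟨hq2, hdq⟩ := two_le_add_one_and_le_inv hp hq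
  obtain ⟨C, hC⟩ := exists_eLpNorm_val_le hd hΩ hq2 hdq
  have hφ : MemLp φ.val q (volume.restrict Ω) :=
    ⟨aestronglyMeasurable_val φ, (hC φ).trans_lt (by finiteness)⟩
  -- Chosen so that `p δ^(p-1) C² ≤ ε`; the added `1` guards against `C = 0`.
  let δ : ℝ≥0 := (ε / (p.toNNReal * (C ^ 2 + 1))) ^ (p - 1)⁻¹
  have hp0' : 0 < p.toNNReal := Real.toNNReal_pos.2 hp0
  have hδ : 0 < δ := NNReal.rpow_pos (by positivity)
  have hδ' : p.toNNReal * (δ ^ (p - 1) * C ^ 2) ≤ ε := by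
    have h1 : δ ^ (p - 1) = ε / (p.toNNReal * (C ^ 2 + 1)) := by
      rw [← NNReal.rpow_mul, inv_mul_cancel₀ hp1.ne', NNReal.rpow_one]
    calc p.toNNReal * (δ ^ (p - 1) * C ^ 2)
        ≤ p.toNNReal * (δ ^ (p - 1) * (C ^ 2 + 1)) := by gcongr; simp
      _ = ε := by rw [h1]; field_simp
  have hφm : StronglyMeasurable φ.val := Lp.stronglyMeasurable _
  obtain ⟨M, hM0, hM⟩ := hφ.eLpNorm_indicator_norm_ge_pos_le hφm (NNReal.coe_pos.2 hδ)
  rw [ENNReal.ofReal_coe_nnreal] at hM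
  set s : Set (EuclideanSpace ℝ (Fin d)) := {x | M ≤ ‖φ.val x‖₊}
  have hsm : MeasurableSet s := measurableSet_le measurable_const hφm.measurable.norm
  have hpt : ∀ x, ‖φ.val x‖ₑ ^ (p - 1)
      ≤ ((M.toNNReal ^ (p - 1) : ℝ≥0) : ℝ≥0∞) + ‖s.indicator φ.val x‖ₑ ^ (p - 1) := by
    intro x
    by_cases hx : x ∈ s
    · rw [Set.indicator_of_mem hx]
      exact le_add_self
    · refine le_add_right ?_
      have h1 : ‖φ.val x‖ ≤ M := (not_le.1 hx).le
      rw [ENNReal.coe_rpow_of_nonneg _ hp1.le]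
      refine ENNReal.rpow_le_rpow ?_ hp1.le
      rw [← ofReal_norm]
      exact ENNReal.ofReal_le_ofReal h1
  refine ⟨p.toNNReal * M.toNNReal ^ (p - 1), fun u => ?_⟩
  have hum : AEMeasurable (fun x => ‖u.val x‖ₑ ^ 2) (volume.restrict Ω) :=
    (aestronglyMeasurable_val u).enorm.pow_const 2
  have hu2 : ∫⁻ x in Ω, ‖u.val x‖ₑ ^ 2 = ‖toL2 Ω u‖ₑ ^ 2 := by
    rw [Lp.enorm_def, sq_eLpNorm_two]
    rfl
  have hhol : ∫⁻ x in Ω, ‖s.indicator φ.val x‖ₑ ^ (p - 1) * ‖u.val x‖ₑ ^ 2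
      ≤ (δ ^ (p - 1) * C ^ 2 : ℝ≥0) * ‖u‖ₑ ^ 2 := by
    refine (lintegral_rpow_mul_sq_le _ hp.1 hq ((hφm.indicator hsm).aestronglyMeasurable)
      (aestronglyMeasurable_val u)).trans ?_
    rw [ENNReal.coe_mul, ENNReal.coe_pow, mul_assoc, ← mul_pow,
      ENNReal.coe_rpow_of_nonneg _ hp1.le]
    exact mul_le_mul' (ENNReal.rpow_le_rpow hM hp1.le) (pow_le_pow_left' (hC u) 2)
  rw [sq_eLpNorm_two]
  simp only [enorm_sqrtPotential_mul_sq hp.1]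
  calc ∫⁻ x in Ω, ENNReal.ofReal p * (‖φ.val x‖ₑ ^ (p - 1) * ‖u.val x‖ₑ ^ 2)
      ≤ ∫⁻ x in Ω, ENNReal.ofReal p * (((M.toNNReal ^ (p - 1) : ℝ≥0) : ℝ≥0∞) * ‖u.val x‖ₑ ^ 2
          + ‖s.indicator φ.val x‖ₑ ^ (p - 1) * ‖u.val x‖ₑ ^ 2) := by
        refine lintegral_mono fun x => mul_le_mul_right ?_ _
        rw [← add_mul]
        exact mul_le_mul_left (hpt x) _
    _ = ENNReal.ofReal p * (((M.toNNReal ^ (p - 1) : ℝ≥0) : ℝ≥0∞) * ‖toL2 Ω u‖ₑ ^ 2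
          + ∫⁻ x in Ω, ‖s.indicator φ.val x‖ₑ ^ (p - 1) * ‖u.val x‖ₑ ^ 2) := by
        rw [lintegral_const_mul' _ _ ENNReal.ofReal_ne_top, lintegral_add_left' (hum.const_mul _),
          lintegral_const_mul' _ _ ENNReal.coe_ne_top, hu2]
    _ ≤ ENNReal.ofReal p * (((M.toNNReal ^ (p - 1) : ℝ≥0) : ℝ≥0∞) * ‖toL2 Ω u‖ₑ ^ 2
          + (δ ^ (p - 1) * C ^ 2 : ℝ≥0) * ‖u‖ₑ ^ 2) := by gcongr
    _ = (p.toNNReal * M.toNNReal ^ (p - 1) : ℝ≥0) * ‖toL2 Ω u‖ₑ ^ 2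
          + (p.toNNReal * (δ ^ (p - 1) * C ^ 2) : ℝ≥0) * ‖u‖ₑ ^ 2 := by
        rw [mul_add, ← mul_assoc, ← mul_assoc, ENNReal.coe_mul p.toNNReal,
          ENNReal.coe_mul p.toNNReal]
        rfl
    _ ≤ _ := by gcongr

/-- Real form of `exists_sq_eLpNorm_sqrtPotential_mul_le`, with the square-integrability it
gives. -/
theorem exists_sq_norm_sqrtPotential_mul_le (hd : 1 ≤ d) (hΩ : Bornology.IsBounded Ω) {p : ℝ}
    (hp : Subcritical d p) (φ : H10 Ω) {ε : ℝ} (hε : 0 < ε) :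
    ∃ A : ℝ, 0 ≤ A ∧ ∀ u : H10 Ω,
      ∃ h : MemLp (fun x => sqrtPotential p φ x * u.val x) 2 (volume.restrict Ω),
        ‖h.toLp‖ ^ 2 ≤ A * ‖toL2 Ω u‖ ^ 2 + ε * ‖u‖ ^ 2 := by
  lift ε to ℝ≥0 using hε.le
  obtain ⟨A, hA⟩ := exists_sq_eLpNorm_sqrtPotential_mul_le hd hΩ hp φ (NNReal.coe_pos.1 hε)
  refine ⟨A, A.2, fun u => ?_⟩
  have hfin1 : (A : ℝ≥0∞) * ‖toL2 Ω u‖ₑ ^ 2 ≠ ⊤ := by finiteness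
  have hfin2 : (ε : ℝ≥0∞) * ‖u‖ₑ ^ 2 ≠ ⊤ := by finiteness
  have hfin := ENNReal.add_ne_top.2 ⟨hfin1, hfin2⟩
  have hmem : MemLp (fun x => sqrtPotential p φ x * u.val x) 2 (volume.restrict Ω) := by
    refine ⟨aestronglyMeasurable_sqrtPotential_mul p φ u, ?_⟩
    by_contra htop
    have h1 := hA u
    rw [not_lt_top_iff.1 htop] at h1
    exact hfin (top_le_iff.1 (by simpa using h1))
  refine ⟨hmem, ?_⟩
  have h1 := ENNReal.toReal_mono hfin (hA u)
  rw [ENNReal.toReal_add hfin1 hfin2, ENNReal.toReal_mul, ENNReal.toReal_mul] at h1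
  simpa [Lp.norm_toLp] using h1

/-- Multiplication by the square root of the potential `p |φ|^(p-1)` is a compact operator from
`H¹₀(Ω)` to `L²(Ω)`. -/
theorem exists_sqrtPotential_operator (hd : 1 ≤ d) (hΩ : Bornology.IsBounded Ω) {p : ℝ}
    (hp : Subcritical d p) (φ : H10 Ω) :
    ∃ S : H10 Ω →L[ℝ] Lp ℝ 2 (volume.restrict Ω), IsCompactOperator S ∧
      ∀ u, S u =ᵐ[volume.restrict Ω] fun x => sqrtPotential p φ x * u.val x := by
  -- The choice `ε = 1` already gives boundedness, with norm at most `√(A + 1)`.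
  obtain ⟨A, hA0, hA⟩ := exists_sq_norm_sqrtPotential_mul_le hd hΩ hp φ one_pos
  choose hmem hA using hA
  let S₀ : H10 Ω →ₗ[ℝ] Lp ℝ 2 (volume.restrict Ω) :=
    { toFun := fun u => (hmem u).toLp
      map_add' := fun u v => by
        rw [← MemLp.toLp_add]
        refine MemLp.toLp_congr _ _ ?_
        filter_upwards [Lp.coeFn_add (toL2 Ω u) (toL2 Ω v)] with x hx
        have hx' : (u + v).val x = u.val x + v.val x := hx
        simp [hx', mul_add]
      map_smul' := fun c u => by
        rw [RingHom.id_apply, ← MemLp.toLp_const_smul]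
        refine MemLp.toLp_congr _ _ ?_
        filter_upwards [Lp.coeFn_smul c (toL2 Ω u)] with x hx
        have hx' : (c • u).val x = c * u.val x := hx
        simp [hx', mul_left_comm] }
  have htoL2 : ∀ u : H10 Ω, ‖toL2 Ω u‖ ≤ ‖u‖ := fun u => norm_fst_le (u : PairSpace Ω)
  let S : H10 Ω →L[ℝ] Lp ℝ 2 (volume.restrict Ω) := S₀.mkContinuous (Real.sqrt (A + 1)) (by
    intro u
    refine le_of_sq_le_sq ((hA u).trans ?_) (by positivity)
    rw [mul_pow, Real.sq_sqrt (by positivity), add_mul]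
    have := htoL2 u
    gcongr)
  refine ⟨S, isCompactOperator_of_small_on_orthogonal S fun ε hε => ?_,
    fun u => (hmem u).coeFn_toLp⟩
  obtain ⟨B, hB0, hB⟩ := exists_sq_norm_sqrtPotential_mul_le hd hΩ hp φ
    (ε := ε ^ 2 / 2) (by positivity)
  -- The budget `ε²` is split in halves; `B + 1` avoids division by zero.
  obtain ⟨W, hWfin, hW⟩ := exists_finiteDimensional_norm_toL2_le hΩ
    (ε := Real.sqrt (ε ^ 2 / (2 * (B + 1)))) (by positivity)
  refine ⟨W, hWfin, fun u hu => le_of_sq_le_sq ?_ (by positivity)⟩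
  obtain ⟨h, hle⟩ := hB u
  have h1 : ‖toL2 Ω u‖ ^ 2 ≤ ε ^ 2 / (2 * (B + 1)) * ‖u‖ ^ 2 := by
    refine (pow_le_pow_left₀ (norm_nonneg _) (hW u hu) 2).trans_eq ?_
    rw [mul_pow, Real.sq_sqrt (by positivity)]
  have h2 : B * ‖toL2 Ω u‖ ^ 2 ≤ ε ^ 2 / 2 * ‖u‖ ^ 2 := by
    calc B * ‖toL2 Ω u‖ ^ 2 ≤ (B + 1) * (ε ^ 2 / (2 * (B + 1)) * ‖u‖ ^ 2) := by gcongr; simp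
      _ = ε ^ 2 / 2 * ‖u‖ ^ 2 := by field_simp
  calc ‖S u‖ ^ 2 ≤ B * ‖toL2 Ω u‖ ^ 2 + ε ^ 2 / 2 * ‖u‖ ^ 2 := hle
    _ ≤ (ε * ‖u‖) ^ 2 := by rw [mul_pow]; linarith

theorem nonempty_of_ne_zero {φ : H10 Ω} (hφ : φ ≠ 0) : Ω.Nonempty := by
  by_contra hne
  rw [Set.not_nonempty_iff_eq_empty] at hne
  subst hne
  refine hφ (inner_self_eq_zero (𝕜 := ℝ).1 ?_)
  rw [H10.inner_eq]
  simp

/-- Needed to split the integral in the weak equation into the `H¹` pairing and the nonlinear term.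
-/
theorem integrableOn_inner (u v : H10 Ω) :
    IntegrableOn (fun x => u.val x * v.val x + inner ℝ (u.grad x) (v.grad x)) Ω := by
  have h1 := L2.integrable_inner (𝕜 := ℝ) (u : PairSpace Ω).fst (v : PairSpace Ω).fst
  have h2 := L2.integrable_inner (𝕜 := ℝ) (u : PairSpace Ω).snd (v : PairSpace Ω).snd
  refine (h1.add h2).congr (Eventually.of_forall fun x => ?_)
  exact congrArg₂ (fun a b : ℝ => a + b) (mul_comm (v.val x) (u.val x)) rfl

/-- A weak solution is an eigenvector of the linearized operator for the eigenvalue `p`. -/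
theorem apply_eq_smul_of_isWeakSolution {p : ℝ} (hp : 0 < p) {φ : H10 Ω}
    (hφ : IsWeakSolution p φ) {T : H10 Ω →L[ℝ] H10 Ω}
    (hT : ∀ h v : H10 Ω, IntegrableOn (fun x => p * |φ.val x| ^ (p - 1) * h.val x * v.val x) Ω ∧
      inner ℝ (T h) v = ∫ x in Ω, p * |φ.val x| ^ (p - 1) * h.val x * v.val x) :
    T φ = p • φ := by
  refine ext_inner_right ℝ fun v => ?_
  obtain ⟨hint, heq⟩ := hT φ v
  have hint' : IntegrableOn (fun x => |φ.val x| ^ (p - 1) * φ.val x * v.val x) Ω := by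
    refine (hint.const_mul p⁻¹).congr (Eventually.of_forall fun x => ?_)
    simp only
    field_simp
  have h0 := hφ v
  have h1 : ∫ x in Ω, (inner ℝ (φ.grad x) (v.grad x) + φ.val x * v.val x
      - |φ.val x| ^ (p - 1) * φ.val x * v.val x)
      = (∫ x in Ω, (φ.val x * v.val x + inner ℝ (φ.grad x) (v.grad x)))
        - ∫ x in Ω, |φ.val x| ^ (p - 1) * φ.val x * v.val x := by
    rw [← integral_sub (integrableOn_inner φ v) hint']
    refine integral_congr_ae (Eventually.of_forall fun x => ?_)
    simp only
    ring
  rw [h1, ← H10.inner_eq, sub_eq_zero] at h0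
  have hsmul : inner ℝ (p • φ) v = p * inner ℝ φ v := real_inner_smul_left φ v p
  rw [heq, hsmul, h0, ← integral_const_mul]
  refine integral_congr_ae (Eventually.of_forall fun x => ?_)
  simp only
  ring

/-- The linearized operator: a compact positive operator on `H¹₀(Ω)` that represents the
quadratic form of the potential `p |φ|^(p-1)`. -/
theorem exists_linearizedOperator (hd : 1 ≤ d) (hΩ : Bornology.IsBounded Ω) {p : ℝ}
    (hp : Subcritical d p) (φ : H10 Ω) :
    ∃ T : H10 Ω →L[ℝ] H10 Ω, IsCompactOperator T ∧ T.IsSymmetric ∧ (∀ u, 0 ≤ inner ℝ (T u) u) ∧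
      ∀ h v : H10 Ω, IntegrableOn (fun x => p * |φ.val x| ^ (p - 1) * h.val x * v.val x) Ω ∧
        inner ℝ (T h) v = ∫ x in Ω, p * |φ.val x| ^ (p - 1) * h.val x * v.val x := by
  have hp0 : 0 < p := by linarith [hp.1]
  obtain ⟨S, hS, hSae⟩ := exists_sqrtPotential_operator hd hΩ hp φ
  -- The adjoint is taken for the `H¹` inner product, so it already contains the inverse of `I - Δ`.
  let T : H10 Ω →L[ℝ] H10 Ω := ContinuousLinearMap.adjoint S ∘L S
  have hTinner : ∀ h v, inner ℝ (T h) v = inner ℝ (S h) (S v) := fun h v =>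
    ContinuousLinearMap.adjoint_inner_left S v (S h)
  have hT : ∀ h v : H10 Ω,
      IntegrableOn (fun x => p * |φ.val x| ^ (p - 1) * h.val x * v.val x) Ω ∧
      inner ℝ (T h) v = ∫ x in Ω, p * |φ.val x| ^ (p - 1) * h.val x * v.val x := by
    intro h v
    have hae : (fun x => inner ℝ (S h x) (S v x)) =ᵐ[volume.restrict Ω]
        fun x => p * |φ.val x| ^ (p - 1) * h.val x * v.val x := by
      filter_upwards [hSae h, hSae v] with x h1 h2
      rw [h1, h2, ← sqrtPotential_mul_self hp0.le]
      simp only [RCLike.inner_apply, conj_trivial]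
      ring
    refine ⟨(L2.integrable_inner (S h) (S v)).congr hae, ?_⟩
    rw [hTinner, L2.inner_def, integral_congr_ae hae]
  have hsymm : ∀ u v, inner ℝ (T u) v = inner ℝ u (T v) := fun u v => by
    rw [hTinner, real_inner_comm, ← hTinner, real_inner_comm]
  refine ⟨T, hS.clm_comp (ContinuousLinearMap.adjoint S), hsymm, fun u => ?_, hT⟩
  rw [hTinner]
  exact real_inner_self_nonneg

end Linearization

end BoundState

end

/-! ### Assembly of the spectral statement -/

theorem theoremt {d : ℕ} (hd : 1 ≤ d) (Ω : Set (EuclideanSpace ℝ (Fin d)))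
    (hΩ_open : IsOpen Ω) (hΩ_convex : Convex ℝ Ω) (hΩ_bdd : Bornology.IsBounded Ω)
    (p : ℝ) (hp : BoundState.Subcritical d p)
    (φ : BoundState.H10 Ω) (hφ : BoundState.IsWeakSolution p φ) (hφ0 : φ ≠ 0) :
    ∃ T : BoundState.H10 Ω →L[ℝ] BoundState.H10 Ω,
      BoundState.IsLinearizedOperator p φ T ∧
      IsCompactOperator T ∧
      IsSelfAdjoint T ∧
      (∀ z ∈ BoundState.complexSpectrum T, z.im = 0) ∧
      (∃ (ψ : HilbertBasis ℕ ℝ (BoundState.H10 Ω)) (ν : ℕ → ℝ),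
        (∀ j, T (ψ j) = ν j • ψ j) ∧ (∀ j, 0 ≤ ν j) ∧ Tendsto ν atTop (𝓝 0)) ∧
      Module.End.HasEigenvector (T : BoundState.H10 Ω →ₗ[ℝ] BoundState.H10 Ω) p φ := by
  have hp0 : 0 < p := by linarith [hp.1]
  obtain ⟨T, hcompact, hsymm, hpos, hT⟩ := BoundState.exists_linearizedOperator hd hΩ_bdd hp φ
  have hsa : IsSelfAdjoint T := hsymm.isSelfAdjoint
  have := BoundState.separableSpace_H10 Ω
  refine ⟨T, fun h => ?_, hcompact, hsa,
    fun z hz => BoundState.im_eq_zero_of_mem_complexSpectrum hsa hz, ?_, ?_⟩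
  -- The functional is the Riesz image of `T h`, whose values are the integrals supplied by `hT`.
  · refine ⟨BoundState.helmholtz Ω (T h), fun v => hT h v, ?_⟩
    rw [LinearIsometryEquiv.symm_apply_apply]
  · exact BoundState.exists_hilbertBasis_eigenvectors (BoundState.not_finiteDimensional_H10 hd
      hΩ_open (BoundState.nonempty_of_ne_zero hφ0)) hcompact hsymm hpos
  · exact ⟨Module.End.mem_eigenspace_iff.2
      (BoundState.apply_eq_smul_of_isWeakSolution hp0 hφ hT), hφ0⟩
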